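/- Let $N\ge 1$, let $\Omega\subset\mathbb{R}^N$ be a bounded open set, and let $p>1$ and $1\le q<r<p^*$, where $p^*=\frac{Np}{N-p}$ if $p<N$ and $p^*=+\infty$ if $p\ge N$. For $\alpha\in\mathbb{R}$ define $$R_\alpha(u)=\frac{\int_\Omega|\nabla u|^p\,dx}{\left(\int_\Omega|u|^q\,dx\right)^{\frac{\alpha p}{q}}\left(\int_\Omega|u|^r\,dx\right)^{\frac{(1-\alpha)p}{r}}},\qquad u\in W_0^{1,p}(\Omega)\setminus\{0\}.$$ A function $u\in W_0^{1,p}(\Omega)\setminus\{0\}$ is called a critical point of $R_\alpha$ if $R_\alpha$ is Fréchet differentiable at $u$ (as a functional on $W_0^{1,p}(\Omega)$) and $R_\alpha'(u)=0$. Let $\alpha_1,\alpha_2\in\mathbb{R}$ with $\alpha_1\neq\alpha_2$. Then no $u\in W_0^{1,p}(\Omega)\setminus\{0\}$ is a critical point of both $R_{\alpha_1}$ and $R_{\alpha_2}$. Equivalently, if $u_1$ is a critical point of $R_{\alpha_1}$ and $u_2$ is a critical point of $R_{\alpha_2}$, then $u_1$ and $u_2$ are linearly independent. -/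

import Mathlib

open MeasureTheory
open scoped ContDiff

noncomputable section

namespace Rayleigh

/-- The exponent `p : ℝ`, `p > 1`, is an admissible exponent for the normed spaces `Lp`. -/
instance fact_one_le_ofReal (p : ℝ) [hp : Fact (1 < p)] : Fact (1 ≤ ENNReal.ofReal p) :=
  ⟨by simpa using ENNReal.ofReal_le_ofReal hp.out.le⟩

/-- Pairs (function, vector field) in `L^p(Ω) × L^p(Ω; ℝ^N)`. The norm is the maximum of the two
`L^p` norms, so on pairs `(u, ∇u)` it is equivalent to the usual norm of `W^{1,p}(Ω)`. -/
abbrev LpPair (N : ℕ) (p : ℝ) (Ω : Set (EuclideanSpace ℝ (Fin N))) : Type :=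
  Lp ℝ (ENNReal.ofReal p) (volume.restrict Ω) ×
    Lp (EuclideanSpace ℝ (Fin N)) (ENNReal.ofReal p) (volume.restrict Ω)

/-- The linear space of the pairs `(φ, ∇φ)` with `φ ∈ C_c^∞(Ω)`. -/
def testPairs (N : ℕ) (p : ℝ) (Ω : Set (EuclideanSpace ℝ (Fin N))) :
    Submodule ℝ (LpPair N p Ω) where
  carrier := {w | ∃ φ : EuclideanSpace ℝ (Fin N) → ℝ, ContDiff ℝ ∞ φ ∧ HasCompactSupport φ ∧
    tsupport φ ⊆ Ω ∧ w.1 =ᵐ[volume.restrict Ω] φ ∧ w.2 =ᵐ[volume.restrict Ω] gradient φ}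
  zero_mem' := by
    refine ⟨fun _ => 0, contDiff_const, HasCompactSupport.zero, by simp [tsupport], ?_, ?_⟩
    · exact Lp.coeFn_zero _ _ _
    · have h : gradient (fun _ : EuclideanSpace ℝ (Fin N) => (0 : ℝ)) = 0 := by
        funext x; simp [gradient]
      rw [h]
      exact Lp.coeFn_zero _ _ _
  add_mem' := by
    rintro v w ⟨φ, hφ, hφc, hφs, hv1, hv2⟩ ⟨ψ, hψ, hψc, hψs, hw1, hw2⟩
    refine ⟨φ + ψ, hφ.add hψ, hφc.add hψc,
      (tsupport_add φ ψ).trans (Set.union_subset hφs hψs), ?_, ?_⟩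
    · exact (Lp.coeFn_add v.1 w.1).trans (hv1.add hw1)
    · have h : gradient (φ + ψ) = gradient φ + gradient ψ := by
        funext x
        simp only [gradient, Pi.add_apply]
        rw [fderiv_add (hφ.differentiable (by simp) x) (hψ.differentiable (by simp) x), map_add]
      rw [h]
      exact (Lp.coeFn_add v.2 w.2).trans (hv2.add hw2)
  smul_mem' := by
    rintro c w ⟨φ, hφ, hφc, hφs, hw1, hw2⟩
    refine ⟨c • φ, hφ.const_smul c, hφc.smul_left (f := fun _ => c),
      (tsupport_smul_subset_right (fun _ => c) φ).trans hφs, ?_, ?_⟩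
    · exact (Lp.coeFn_smul c w.1).trans (hw1.const_smul c)
    · have h : gradient (c • φ) = c • gradient φ := by
        funext x
        simp only [gradient, Pi.smul_apply]
        rw [fderiv_const_smul (hφ.differentiable (by simp) x) c]
        simp
      rw [h]
      exact (Lp.coeFn_smul c w.2).trans (hw2.const_smul c)

/-- The Sobolev space `W_0^{1,p}(Ω)`: the closure of `C_c^∞(Ω)` in the norm of `W^{1,p}(Ω)`.
An element is stored as the pair `(u, ∇u)` of the function and its weak gradient; the second
component is determined by the first. -/
def sobolevZero (N : ℕ) (p : ℝ) [Fact (1 < p)] (Ω : Set (EuclideanSpace ℝ (Fin N))) :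
    Submodule ℝ (LpPair N p Ω) :=
  (testPairs N p Ω).topologicalClosure

variable {N : ℕ} {p : ℝ} [Fact (1 < p)] {Ω : Set (EuclideanSpace ℝ (Fin N))}

/-- The Rayleigh quotient
`R_α(u) = ∫_Ω |∇u|^p / ((∫_Ω |u|^q)^(αp/q) (∫_Ω |u|^r)^((1-α)p/r))` for `u ∈ W_0^{1,p}(Ω)`
(only its values at `u ≠ 0` are meaningful). -/
def rayleighQuotient (q r α : ℝ) (u : sobolevZero N p Ω) : ℝ :=
  (∫ x in Ω, ‖u.1.2 x‖ ^ p) /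
    ((∫ x in Ω, |u.1.1 x| ^ q) ^ (α * p / q) * (∫ x in Ω, |u.1.1 x| ^ r) ^ ((1 - α) * p / r))

/-- `u` is a critical point of `R_α`: `u ∈ W_0^{1,p}(Ω) ∖ {0}` and `R_α'(u) = 0`, the derivative
being the Fréchet derivative on `W_0^{1,p}(Ω)`. -/
def IsCriticalPoint (q r α : ℝ) (u : sobolevZero N p Ω) : Prop :=
  u ≠ 0 ∧ HasFDerivAt (rayleighQuotient q r α) (0 : sobolevZero N p Ω →L[ℝ] ℝ) u

end Rayleigh

end

/-! ### Sobolev inequality for test functions and its passage to the closure. -/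

namespace Rayleigh

open Filter Topology

/-! Write `A = ∫|u|^q` and `B = ∫|u|^r`. In `log R_α₁ - log R_α₂` the gradient integral cancels,
leaving `(α₂ - α₁) p (log A / q - log B / r)`. A common critical point is thus critical for `‖u‖_q /
‖u‖_r`, a quotient without derivatives. Its Euler–Lagrange equation is pointwise: `|u|^(q-2) u / A =
|u|^(r-2) u / B` a.e. (`integral_mul_eq_of_isCriticalPoint` and the fundamental lemma of the
calculus of variations). Since `q < r`, `|u|` takes at most one nonzero value `c`.

Such a Sobolev function has zero weak gradient (`snd_eq_zero_of_abs_eq`): with `k = 2π/c`, `sin (k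
u) = 0` and `cos (k u) = 1`, so the chain rule `∇ sin (k u) = k cos (k u) ∇u` gives `∇u = 0`. The
Sobolev inequality on `W_0^{1,p}(Ω)` then forces `u = 0`.

For `q = 1` the integral `∫|u|^q` need not be differentiable a priori. Along a line, stationarity of
both quotients expresses it through `∫|u|^r`, which is differentiable as `r > 1`
(`hasDerivAt_of_stationary`); symmetric difference quotients then identify its derivative.

Linear independence follows because `R_α` is invariant under nonzero scaling. -/

lemma enorm_gradient {N : ℕ} (φ : EuclideanSpace ℝ (Fin N) → ℝ) (x : EuclideanSpace ℝ (Fin N)) :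
    ‖gradient φ x‖ₑ = ‖fderiv ℝ φ x‖ₑ := by
  rw [gradient, LinearIsometryEquiv.enorm_map]

lemma inner_gradient {N : ℕ} (φ : EuclideanSpace ℝ (Fin N) → ℝ) (x v : EuclideanSpace ℝ (Fin N)) :
    inner ℝ (gradient φ x) v = fderiv ℝ φ x v := by
  rw [gradient, InnerProductSpace.toDual_symm_apply]

lemma continuous_gradient {N : ℕ} {φ : EuclideanSpace ℝ (Fin N) → ℝ} (hφ : ContDiff ℝ ∞ φ) :
    Continuous (gradient φ) :=
  (LinearIsometryEquiv.continuous _).comp (hφ.continuous_fderiv (by simp))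

lemma support_gradient_subset {N : ℕ} (φ : EuclideanSpace ℝ (Fin N) → ℝ) :
    Function.support (gradient φ) ⊆ tsupport φ := by
  intro x hx
  refine support_fderiv_subset ℝ ?_
  simpa [gradient] using hx

lemma hasCompactSupport_gradient {N : ℕ} {φ : EuclideanSpace ℝ (Fin N) → ℝ}
    (hφc : HasCompactSupport φ) : HasCompactSupport (gradient φ) :=
  hφc.mono' (support_gradient_subset φ)

lemma eLpNorm_gradient_restrict {N : ℕ} {Ω : Set (EuclideanSpace ℝ (Fin N))}
    {φ : EuclideanSpace ℝ (Fin N) → ℝ} (hφs : tsupport φ ⊆ Ω) (p : ENNReal) :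
    eLpNorm (gradient φ) p (volume.restrict Ω) = eLpNorm (fderiv ℝ φ) p volume := by
  rw [eLpNorm_restrict_eq_of_support_subset ((support_gradient_subset φ).trans hφs)]
  exact eLpNorm_congr_enorm_ae (.of_forall fun x => enorm_gradient φ x)

/-- A compactly supported function of one variable is bounded by the `L¹` norm of its
derivative. -/
lemma enorm_le_eLpNorm_one_fderiv {φ : EuclideanSpace ℝ (Fin 1) → ℝ} (hφ : ContDiff ℝ 1 φ)
    (hφc : HasCompactSupport φ) (x : EuclideanSpace ℝ (Fin 1)) :
    ‖φ x‖ₑ ≤ eLpNorm (fderiv ℝ φ) 1 volume := by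
  let e : EuclideanSpace ℝ (Fin 1) ≃ₗᵢ[ℝ] ℝ :=
    (stdOrthonormalBasis ℝ (EuclideanSpace ℝ (Fin 1))).equiv (stdOrthonormalBasis ℝ ℝ)
      (finCongr (by simp))
  have hs : ContDiff ℝ 1 (φ ∘ e.symm) := hφ.comp e.symm.contDiff
  have hc : HasCompactSupport (φ ∘ e.symm) := hφc.comp_homeomorph e.symm.toHomeomorph
  have key := hc.enorm_le_lintegral_Ici_deriv hs (e x)
  simp only [Function.comp_apply, LinearIsometryEquiv.symm_apply_apply] at key
  refine key.trans ?_
  rw [eLpNorm_one_eq_lintegral_enorm,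
    ← e.symm.measurePreserving.lintegral_comp_emb e.symm.toHomeomorph.measurableEmbedding]
  refine (setLIntegral_le_lintegral _ _).trans (lintegral_mono fun y => ?_)
  have hd : deriv (φ ∘ e.symm) y = fderiv ℝ φ (e.symm y) (e.symm 1) := by
    rw [← fderiv_apply_one_eq_deriv, fderiv_comp y (hφ.differentiable (by simp) _)
      e.symm.differentiableAt, LinearIsometryEquiv.fderiv]
    rfl
  rw [hd]
  refine (ContinuousLinearMap.le_opENorm _ _).trans ?_
  simp [enorm_eq_nnnorm]

/-- The Sobolev inequality on `C_c^∞(Ω)` for bounded `Ω` and subcritical exponents. -/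
lemma exists_eLpNorm_le_eLpNorm_gradient {N : ℕ} (hN : 1 ≤ N) {p r : ℝ} (hp : 1 < p) (hr1 : 1 ≤ r)
    (hr : p < N → r < N * p / (N - p)) {Ω : Set (EuclideanSpace ℝ (Fin N))}
    (hΩb : Bornology.IsBounded Ω) :
    ∃ C : ENNReal, C ≠ ⊤ ∧ ∀ φ : EuclideanSpace ℝ (Fin N) → ℝ, ContDiff ℝ ∞ φ →
      HasCompactSupport φ → tsupport φ ⊆ Ω →
      eLpNorm φ (ENNReal.ofReal r) (volume.restrict Ω) ≤
        C * eLpNorm (gradient φ) (ENNReal.ofReal p) (volume.restrict Ω) := by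
  have hΩf : volume Ω ≠ ⊤ := hΩb.measure_lt_top.ne
  have hfin : IsFiniteMeasure (volume.restrict Ω) := ⟨by simpa using hΩf.lt_top⟩
  -- Hölder on the finite-measure set `Ω`: it suffices to bound by the gradient in some `L^s` with
  -- `s ≤ p`.
  have hlow : ∀ s : ℝ, 1 ≤ s → s ≤ p → ∃ C : ENNReal, C ≠ ⊤ ∧
      ∀ φ : EuclideanSpace ℝ (Fin N) → ℝ, ContDiff ℝ ∞ φ → tsupport φ ⊆ Ω →
      eLpNorm (fderiv ℝ φ) (ENNReal.ofReal s) volume ≤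
        C * eLpNorm (gradient φ) (ENNReal.ofReal p) (volume.restrict Ω) := by
    intro s hs hsp
    refine ⟨volume Ω ^ (1 / s - 1 / p), ?_, fun φ hφ hφs => ?_⟩
    · refine ENNReal.rpow_ne_top_of_nonneg ?_ hΩf
      rw [sub_nonneg]
      exact one_div_le_one_div_of_le (by linarith) hsp
    · rw [← eLpNorm_gradient_restrict hφs, mul_comm]
      have := eLpNorm_le_eLpNorm_mul_rpow_measure_univ (μ := volume.restrict Ω) (f := gradient φ)
        (ENNReal.ofReal_le_ofReal hsp) (continuous_gradient hφ).aestronglyMeasurable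
      rwa [ENNReal.toReal_ofReal (by linarith), ENNReal.toReal_ofReal (by linarith),
        Measure.restrict_apply_univ] at this
  -- Gagliardo–Nirenberg–Sobolev needs `1 ≤ s < N`, which is impossible for `N = 1`.
  rcases hN.eq_or_lt with rfl | hN2
  · obtain ⟨C, hC, h⟩ := hlow 1 le_rfl hp.le
    refine ⟨C * volume Ω ^ (1 / r), by finiteness, fun φ hφ hφc hφs => ?_⟩
    have h1 := eLpNorm_le_of_ae_enorm_bound (μ := volume.restrict Ω) (p := ENNReal.ofReal r)
      (.of_forall (enorm_le_eLpNorm_one_fderiv (hφ.of_le (by simp)) hφc))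
    have h2 := h φ hφ hφs
    rw [ENNReal.ofReal_one] at h2
    refine h1.trans ?_
    rw [Measure.restrict_apply_univ, ENNReal.toReal_ofReal (by linarith), one_div, smul_eq_mul,
      mul_right_comm]
    gcongr
  · have hN2' : (2 : ℝ) ≤ N := by exact_mod_cast hN2
    obtain ⟨s, hs1, hsp, hsN, hsr⟩ : ∃ s : ℝ, 1 ≤ s ∧ s ≤ p ∧ s < N ∧
        s⁻¹ - (N : ℝ)⁻¹ ≤ r⁻¹ := by
      by_cases hpN : p < N
      · refine ⟨p, hp.le, le_rfl, hpN, ?_⟩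
        have h1 := (hr hpN).le
        have h2 : (0 : ℝ) < N - p := by linarith
        have h3 : p⁻¹ - (N : ℝ)⁻¹ = (N * p / (N - p))⁻¹ := by
          field_simp
        rw [h3]
        exact inv_anti₀ (by linarith) h1
      · have hpos : 0 < (N : ℝ)⁻¹ := by positivity
        have hrpos : 0 < r⁻¹ := by positivity
        -- For `p ≥ N`, take `1/s = min(1, 1/N + 1/r)`. This exceeds `1/N`, so `s < N ≤ p`, and the
        -- Sobolev exponent of `s` is at least `r`.
        refine ⟨(min 1 ((N : ℝ)⁻¹ + r⁻¹))⁻¹, ?_, ?_, ?_, ?_⟩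
        · exact (one_le_inv₀ (by positivity)).2 (min_le_left _ _)
        · refine le_trans ?_ (not_lt.1 hpN)
          rw [inv_le_comm₀ (by positivity) (by positivity)]
          exact le_min (inv_le_one_of_one_le₀ (by linarith)) (by linarith)
        · rw [inv_lt_comm₀ (by positivity) (by positivity)]
          exact lt_min (inv_lt_one_of_one_lt₀ (by linarith)) (by linarith)
        · rw [inv_inv]
          linarith [min_le_right 1 ((N : ℝ)⁻¹ + r⁻¹)]
    obtain ⟨C, hC, h⟩ := hlow s hs1 hsp
    refine ⟨eLpNormLESNormFDerivOfLeConst ℝ (volume : Measure (EuclideanSpace ℝ (Fin N))) Ω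
      s.toNNReal r.toNNReal * C, by finiteness, fun φ hφ hφc hφs => ?_⟩
    have h1 := eLpNorm_le_eLpNorm_fderiv_of_le (volume : Measure (EuclideanSpace ℝ (Fin N)))
      (u := φ) (s := Ω) (p := s.toNNReal) (q := r.toNNReal) (hφ.of_le (by simp))
      ((subset_tsupport φ).trans hφs) (by simpa using hs1)
      (by rw [← NNReal.coe_lt_coe, Real.coe_toNNReal _ (by linarith)]; simpa using hsN)
      (by rw [Real.coe_toNNReal _ (by linarith), NNReal.coe_inv, Real.coe_toNNReal _ (by linarith)]
          simpa using hsr) hΩb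
    rw [eLpNorm_restrict_eq_of_support_subset ((subset_tsupport φ).trans hφs), mul_assoc]
    refine h1.trans ?_
    gcongr
    exact h φ hφ hφs

variable {N : ℕ} {p : ℝ} [Fact (1 < p)] {Ω : Set (EuclideanSpace ℝ (Fin N))}

/-- Elements of `W_0^{1,p}(Ω)` are limits of test functions, in norm and almost everywhere. -/
lemma exists_seq_test (u : sobolevZero N p Ω) :
    ∃ (w : ℕ → LpPair N p Ω) (φ : ℕ → EuclideanSpace ℝ (Fin N) → ℝ),
      (∀ n, ContDiff ℝ ∞ (φ n) ∧ HasCompactSupport (φ n) ∧ tsupport (φ n) ⊆ Ω ∧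
        (w n).1 =ᵐ[volume.restrict Ω] φ n ∧ (w n).2 =ᵐ[volume.restrict Ω] gradient (φ n)) ∧
      Tendsto w atTop (𝓝 u.1) ∧
      ∀ᵐ x ∂volume.restrict Ω, Tendsto (fun n => φ n x) atTop (𝓝 (u.1.1 x)) := by
  have hu : u.1 ∈ closure (testPairs N p Ω : Set (LpPair N p Ω)) := u.2
  obtain ⟨w, hw, hwu⟩ := mem_closure_iff_seq_limit.1 hu
  have h1 : Tendsto (fun n => (w n).1) atTop (𝓝 u.1.1) := (continuous_fst.tendsto _).comp hwu
  obtain ⟨ns, hns, hae⟩ := (tendstoInMeasure_of_tendsto_Lp h1).exists_seq_tendsto_ae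
  choose φ hφ using hw
  refine ⟨w ∘ ns, φ ∘ ns, fun n => hφ (ns n), hwu.comp hns.tendsto_atTop, ?_⟩
  have h2 : ∀ᵐ x ∂volume.restrict Ω, ∀ n, (w n).1 x = φ n x :=
    ae_all_iff.2 fun n => (hφ n).2.2.2.1
  filter_upwards [hae, h2] with x hx h2x
  simpa [h2x] using hx

/-- The Sobolev inequality on `W_0^{1,p}(Ω)`. -/
lemma exists_eLpNorm_le_eLpNorm_snd (hN : 1 ≤ N) {r : ℝ} (hr1 : 1 ≤ r)
    (hr : p < N → r < N * p / (N - p)) (hΩb : Bornology.IsBounded Ω) :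
    ∃ C : ENNReal, C ≠ ⊤ ∧ ∀ u : sobolevZero N p Ω,
      eLpNorm u.1.1 (ENNReal.ofReal r) (volume.restrict Ω) ≤ C * ‖u.1.2‖ₑ := by
  obtain ⟨C, hC, h⟩ := exists_eLpNorm_le_eLpNorm_gradient hN (Fact.out : 1 < p) hr1 hr hΩb
  refine ⟨C, hC, fun u => ?_⟩
  obtain ⟨w, φ, hφ, hw, hae⟩ := exists_seq_test u
  have h2 : Tendsto (fun n => C * ‖(w n).2‖ₑ) atTop (𝓝 (C * ‖u.1.2‖ₑ)) :=
    ENNReal.Tendsto.const_mul ((continuous_snd.enorm.tendsto _).comp hw) (.inr hC)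
  -- Fatou: a.e. convergence suffices on the left, so convergence in `L^r` is not needed.
  refine (Lp.eLpNorm_lim_le_liminf_eLpNorm
    (fun n => (hφ n).1.continuous.aestronglyMeasurable) _ hae).trans ?_
  rw [← h2.liminf_eq]
  refine liminf_le_liminf (.of_forall fun n => ?_)
  rw [Lp.enorm_def, eLpNorm_congr_ae (hφ n).2.2.2.2]
  exact h _ (hφ n).1 (hφ n).2.1 (hφ n).2.2.1

lemma memLp_fst (hN : 1 ≤ N) {r : ℝ} (hr1 : 1 ≤ r) (hr : p < N → r < N * p / (N - p))
    (hΩb : Bornology.IsBounded Ω) (u : sobolevZero N p Ω) :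
    MemLp u.1.1 (ENNReal.ofReal r) (volume.restrict Ω) := by
  obtain ⟨C, hC, h⟩ := exists_eLpNorm_le_eLpNorm_snd (p := p) hN hr1 hr hΩb
  exact ⟨Lp.aestronglyMeasurable _, (h u).trans_lt (by finiteness)⟩

lemma eq_zero_of_snd_eq_zero (hN : 1 ≤ N) {r : ℝ} (hr1 : 1 ≤ r)
    (hr : p < N → r < N * p / (N - p)) (hΩb : Bornology.IsBounded Ω) (u : sobolevZero N p Ω)
    (hu : u.1.2 = 0) : u = 0 := by
  obtain ⟨C, hC, h⟩ := exists_eLpNorm_le_eLpNorm_snd (p := p) hN hr1 hr hΩb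
  have h1 := h u
  rw [hu, enorm_zero, mul_zero, nonpos_iff_eq_zero,
    eLpNorm_eq_zero_iff (Lp.aestronglyMeasurable _) (by simp; linarith)] at h1
  ext1
  exact Prod.ext (Lp.eq_zero_iff_ae_eq_zero.2 h1) hu

end Rayleigh

/-! ### Vanishing of the weak gradient. -/

namespace Rayleigh

open Filter Topology

variable {N : ℕ} {p : ℝ} [Fact (1 < p)] {Ω : Set (EuclideanSpace ℝ (Fin N))}

/-- On a finite measure space, convergence in `L^p` implies convergence in mean. -/
lemma tendsto_integral_norm_sub {X E : Type*} [MeasurableSpace X] {μ : Measure X}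
    [IsFiniteMeasure μ] [NormedAddCommGroup E] {p : ENNReal} [Fact (1 ≤ p)] {f : ℕ → Lp E p μ}
    {g : Lp E p μ} (hfg : Tendsto f atTop (𝓝 g)) :
    Tendsto (fun n => ∫ x, ‖f n x - g x‖ ∂μ) atTop (𝓝 0) := by
  set c : ENNReal := μ Set.univ ^ (1 / (1 : ENNReal).toReal - 1 / p.toReal)
  have hp : (1 : ENNReal) ≤ p := Fact.out
  have hc : c ≠ ⊤ := by
    refine ENNReal.rpow_ne_top_of_nonneg ?_ (measure_ne_top _ _)
    rw [sub_nonneg]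
    by_cases h : p = ⊤
    · simp [h]
    · refine one_div_le_one_div_of_le (by simp) ((ENNReal.toReal_le_toReal (by simp) h).2 hp)
  have h1 := (Lp.tendsto_Lp_iff_tendsto_eLpNorm' _ _).1 hfg
  have h2 : Tendsto (fun n => eLpNorm (⇑(f n) - ⇑g) p μ * c) atTop (𝓝 0) := by
    simpa using ENNReal.Tendsto.mul_const h1 (.inr hc)
  have h3 : Tendsto (fun n => eLpNorm (⇑(f n) - ⇑g) 1 μ) atTop (𝓝 0) :=
    tendsto_of_tendsto_of_tendsto_of_le_of_le tendsto_const_nhds h2 (fun _ => zero_le)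
      fun n => eLpNorm_le_eLpNorm_mul_rpow_measure_univ hp
        ((Lp.aestronglyMeasurable _).sub (Lp.aestronglyMeasurable _))
  have h4 := (ENNReal.tendsto_toReal ENNReal.zero_ne_top).comp h3
  refine h4.congr fun n => ?_
  simp only [Function.comp_apply, eLpNorm_one_eq_lintegral_enorm, Pi.sub_apply]
  rw [integral_norm_eq_lintegral_enorm]
  exact (Lp.aestronglyMeasurable _).sub (Lp.aestronglyMeasurable _)

/-- Integration by parts with the chain rule for `sin (k φ)`; both integrands vanish off `tsupport ψ
⊆ Ω`, so there is no boundary term. -/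
lemma setIntegral_sin_mul_fderiv {φ ψ : EuclideanSpace ℝ (Fin N) → ℝ} (hφ : ContDiff ℝ ∞ φ)
    (hψ : ContDiff ℝ ∞ ψ) (hψc : HasCompactSupport ψ) (hψs : tsupport ψ ⊆ Ω) (k : ℝ)
    (v : EuclideanSpace ℝ (Fin N)) :
    ∫ x in Ω, Real.sin (k * φ x) * fderiv ℝ ψ x v =
      -∫ x in Ω, k * (Real.cos (k * φ x) * inner ℝ (gradient φ x) v * ψ x) := by
  have hz : ∀ x, x ∉ Ω → ψ x = 0 := fun x hx =>
    image_eq_zero_of_notMem_tsupport fun h => hx (hψs h)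
  have hz' : ∀ x, x ∉ Ω → fderiv ℝ ψ x = 0 := fun x hx => by
    by_contra h
    exact hx (hψs (support_fderiv_subset ℝ h))
  rw [setIntegral_eq_integral_of_forall_compl_eq_zero (by intro x hx; simp [hz' x hx]),
    setIntegral_eq_integral_of_forall_compl_eq_zero (by intro x hx; simp [hz x hx])]
  have hs : ContDiff ℝ ∞ fun x => Real.sin (k * φ x) := (contDiff_const.mul hφ).sin
  have hder : ∀ x, fderiv ℝ (fun x => Real.sin (k * φ x)) x v =
      k * (Real.cos (k * φ x) * inner ℝ (gradient φ x) v) := by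
    intro x
    have h1 : HasFDerivAt φ (fderiv ℝ φ x) x := (hφ.differentiable (by simp) x).hasFDerivAt
    rw [((h1.const_mul k).sin).fderiv, inner_gradient]
    simp
    ring
  have hd : Continuous fun x => fderiv ℝ ψ x v :=
    (hψ.continuous_fderiv (by simp)).clm_apply continuous_const
  have hd' : Continuous fun x => fderiv ℝ (fun x => Real.sin (k * φ x)) x v :=
    (hs.continuous_fderiv (by simp)).clm_apply continuous_const
  have hdc : HasCompactSupport fun x => fderiv ℝ ψ x v := hψc.fderiv_apply ℝ v
  rw [integral_mul_fderiv_eq_neg_fderiv_mul_of_integrable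
    ((hd'.mul hψ.continuous).integrable_of_hasCompactSupport hψc.mul_left)
    ((hs.continuous.mul hd).integrable_of_hasCompactSupport hdc.mul_left)
    ((hs.continuous.mul hψ.continuous).integrable_of_hasCompactSupport hψc.mul_left)
    (fun x _ => hs.differentiable (by simp) x) (fun x _ => hψ.differentiable (by simp) x)]
  simp_rw [hder]
  congr 2
  ext x
  ring

/-- The weak gradient vanishes if `u` takes values in `(2π/k)ℤ` only. -/
lemma snd_eq_zero_of_sin_cos (hΩ : IsOpen Ω) (hΩb : Bornology.IsBounded Ω)
    (u : sobolevZero N p Ω) {k : ℝ} (hk : k ≠ 0)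
    (hu : ∀ᵐ x ∂volume.restrict Ω, Real.sin (k * u.1.1 x) = 0 ∧ Real.cos (k * u.1.1 x) = 1) :
    u.1.2 = 0 := by
  have hfin : IsFiniteMeasure (volume.restrict Ω) := ⟨by simpa using hΩb.measure_lt_top⟩
  obtain ⟨w, φ, hφ, hw, hae⟩ := exists_seq_test u
  have hw2 : Tendsto (fun n => (w n).2) atTop (𝓝 u.1.2) := (continuous_snd.tendsto _).comp hw
  have hgi : Integrable u.1.2 (volume.restrict Ω) :=
    (Lp.memLp u.1.2).integrable Fact.out
  rw [Lp.eq_zero_iff_ae_eq_zero]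
  suffices h : ∀ ψ : EuclideanSpace ℝ (Fin N) → ℝ, ContDiff ℝ ∞ ψ → HasCompactSupport ψ →
      tsupport ψ ⊆ Ω → ∫ x in Ω, ψ x • u.1.2 x = 0 by
    have h1 := hΩ.ae_eq_zero_of_integral_contDiff_smul_eq_zero (μ := volume.restrict Ω)
      (hgi.locallyIntegrable.locallyIntegrableOn Ω) h
    filter_upwards [h1, ae_restrict_mem hΩ.measurableSet] with x hx hxΩ
    exact hx hxΩ
  intro ψ hψ hψc hψs
  obtain ⟨M, hM⟩ := hψ.continuous.bounded_above_of_compact_support hψc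
  have hM0 : 0 ≤ M := (norm_nonneg _).trans (hM 0)
  have hψg : Integrable (fun x => ψ x • u.1.2 x) (volume.restrict Ω) :=
    hgi.bdd_smul M hψ.continuous.aestronglyMeasurable (.of_forall hM)
  refine ext_inner_left ℝ fun v => ?_
  rw [inner_zero_right, ← integral_inner hψg]
  have hd : Integrable (fun x => fderiv ℝ ψ x v) (volume.restrict Ω) :=
    (((hψ.continuous_fderiv (by simp)).clm_apply continuous_const).integrable_of_hasCompactSupport
      (hψc.fderiv_apply ℝ v)).restrict
  -- The left side of the integration by parts tends to `0`, because `sin (k u) = 0` a.e.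
  have hL : Tendsto (fun n => ∫ x in Ω, Real.sin (k * φ n x) * fderiv ℝ ψ x v) atTop (𝓝 0) := by
    have := tendsto_integral_of_dominated_convergence (μ := volume.restrict Ω)
      (F := fun n x => Real.sin (k * φ n x) * fderiv ℝ ψ x v) (f := fun _ => 0)
      (fun x => ‖fderiv ℝ ψ x v‖)
      (fun n => (Real.continuous_sin.comp
        (continuous_const.mul (hφ n).1.continuous)).aestronglyMeasurable.mul
          hd.aestronglyMeasurable) hd.norm
      (fun n => .of_forall fun x => by
        rw [norm_mul]
        exact mul_le_of_le_one_left (norm_nonneg _) (Real.abs_sin_le_one _)) ?_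
    · simpa using this
    · filter_upwards [hae, hu] with x hx hux
      have := ((Real.continuous_sin.tendsto _).comp (hx.const_mul k)).mul_const (fderiv ℝ ψ x v)
      simpa [hux.1] using this
  -- Split `∇φ_n = ∇u + (∇φ_n - ∇u)`. The first part converges by domination and `cos (k u) = 1`;
  -- the second is small in `L¹`, since `cos` and `ψ` are bounded.
  have hR : Tendsto (fun n => ∫ x in Ω, k * (Real.cos (k * φ n x) *
      inner ℝ (gradient (φ n) x) v * ψ x)) atTop
      (𝓝 (k * ∫ x in Ω, inner ℝ v (ψ x • u.1.2 x))) := by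
    simp_rw [integral_const_mul]
    refine Tendsto.const_mul k ?_
    have hgv : Integrable (fun x => inner ℝ v (ψ x • u.1.2 x)) (volume.restrict Ω) :=
      hψg.const_inner v
    have hcos : ∀ n, Continuous fun x => Real.cos (k * φ n x) := fun n =>
      Real.continuous_cos.comp (continuous_const.mul (hφ n).1.continuous)
    have hA : Tendsto (fun n => ∫ x in Ω, Real.cos (k * φ n x) * inner ℝ v (ψ x • u.1.2 x)) atTop
        (𝓝 (∫ x in Ω, inner ℝ v (ψ x • u.1.2 x))) := by
      refine tendsto_integral_of_dominated_convergence
        (fun x => ‖inner ℝ v (ψ x • u.1.2 x)‖)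
        (fun n => (hcos n).aestronglyMeasurable.mul hgv.aestronglyMeasurable) hgv.norm
        (fun n => .of_forall fun x => ?_) ?_
      · rw [norm_mul]
        exact mul_le_of_le_one_left (norm_nonneg _) (Real.abs_cos_le_one _)
      · filter_upwards [hae, hu] with x hx hux
        have := ((Real.continuous_cos.tendsto _).comp (hx.const_mul k)).mul_const
          (inner ℝ v (ψ x • u.1.2 x))
        simpa [hux.2] using this
    have hB : Tendsto (fun n => ∫ x in Ω, Real.cos (k * φ n x) *
        inner ℝ v (ψ x • ((w n).2 x - u.1.2 x))) atTop (𝓝 0) := by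
      have h0 := (tendsto_integral_norm_sub hw2).const_mul (‖v‖ * M)
      rw [mul_zero] at h0
      refine squeeze_zero_norm (fun n => ?_) h0
      rw [← integral_const_mul]
      refine norm_integral_le_of_norm_le ?_ (.of_forall fun x => ?_)
      · exact (((Lp.memLp _).integrable Fact.out).sub hgi).norm.const_mul _
      · rw [norm_mul]
        refine (mul_le_of_le_one_left (norm_nonneg _) (Real.abs_cos_le_one _)).trans ?_
        refine (norm_inner_le_norm _ _).trans ?_
        rw [norm_smul, mul_assoc]
        gcongr
        exact hM x
    have hAB := hA.add hB
    rw [add_zero] at hAB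
    refine hAB.congr fun n => ?_
    rw [← integral_add]
    · refine integral_congr_ae ?_
      filter_upwards [(hφ n).2.2.2.2] with x hx
      rw [hx, smul_sub, inner_sub_right, real_inner_smul_right, real_inner_smul_right,
        real_inner_comm (gradient (φ n) x)]
      ring
    · exact hgv.bdd_mul (c := 1) (hcos n).aestronglyMeasurable
        (.of_forall fun x => Real.abs_cos_le_one _)
    · refine Integrable.bdd_mul (c := 1) ?_ (hcos n).aestronglyMeasurable
        (.of_forall fun x => Real.abs_cos_le_one _)
      exact ((((Lp.memLp _).integrable Fact.out).sub hgi).bdd_smul M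
        hψ.continuous.aestronglyMeasurable (.of_forall hM)).const_inner v
  have heq := tendsto_nhds_unique hL (hR.neg.congr fun n =>
    (setIntegral_sin_mul_fderiv (hφ n).1 hψ hψc hψs k v).symm)
  simpa [hk] using heq

/-- The weak gradient vanishes if `|u|` takes at most one nonzero value. -/
lemma snd_eq_zero_of_abs_eq (hΩ : IsOpen Ω) (hΩb : Bornology.IsBounded Ω)
    (u : sobolevZero N p Ω) {c : ℝ} (hc : 0 < c)
    (hu : ∀ᵐ x ∂volume.restrict Ω, u.1.1 x = 0 ∨ |u.1.1 x| = c) : u.1.2 = 0 := by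
  refine snd_eq_zero_of_sin_cos hΩ hΩb u (k := 2 * Real.pi / c) (by positivity) ?_
  filter_upwards [hu] with x hx
  rcases hx with hx | hx
  · simp [hx]
  · rcases abs_choice (u.1.1 x) with h | h
    · have : 2 * Real.pi / c * u.1.1 x = 2 * Real.pi := by rw [← h, hx]; field_simp
      simp [this]
    · have : 2 * Real.pi / c * u.1.1 x = -(2 * Real.pi) := by
        rw [← neg_eq_iff_eq_neg, ← mul_neg, ← h, hx]; field_simp
      simp [this]

end Rayleigh

/-! ### Differentiating `∫ |f + t g|^s` in `t`, and eliminating the gradient term. -/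

namespace Rayleigh

open Filter Topology

lemma abs_rpow_sub_rpow_le {s K a b : ℝ} (hs : 1 ≤ s) (ha : a ∈ Set.Icc 0 K)
    (hb : b ∈ Set.Icc 0 K) : |a ^ s - b ^ s| ≤ s * K ^ (s - 1) * |a - b| := by
  refine (convex_Icc 0 K).norm_image_sub_le_of_norm_hasDerivWithin_le
    (f := fun x => x ^ s) (f' := fun x => s * x ^ (s - 1))
    (fun x _ => (Real.hasDerivAt_rpow_const (.inr hs)).hasDerivWithinAt) (fun x hx => ?_) hb ha
  have h1 : 0 ≤ x ^ (s - 1) := Real.rpow_nonneg hx.1 _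
  rw [Real.norm_of_nonneg (by positivity)]
  gcongr
  exacts [hx.1, hx.2]

/-- The Lipschitz bound in `t` that dominates difference quotients. The `+ 1` makes the base at
least `1`, so the exponent `s - 1` may be raised to `s`. -/
lemma abs_add_mul_rpow_sub_le {s M x y t t' : ℝ} (hs : 1 ≤ s) (hy : |y| ≤ M)
    (ht : t ∈ Set.Icc (-1) 1) (ht' : t' ∈ Set.Icc (-1) 1) :
    |(|x + t * y| ^ s - |x + t' * y| ^ s)| ≤ s * (|x| + M + 1) ^ s * M * |t - t'| := by
  have hM : 0 ≤ M := (abs_nonneg _).trans hy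
  have hK : 1 ≤ |x| + M + 1 := by linarith [abs_nonneg x]
  have hmem : ∀ t ∈ Set.Icc (-1 : ℝ) 1, |x + t * y| ∈ Set.Icc 0 (|x| + M + 1) := by
    intro t ht
    refine ⟨abs_nonneg _, (abs_add_le _ _).trans ?_⟩
    have : |t * y| ≤ 1 * M := by
      rw [abs_mul]
      exact mul_le_mul (abs_le.2 ht) hy (abs_nonneg _) zero_le_one
    linarith
  refine (abs_rpow_sub_rpow_le hs (hmem t ht) (hmem t' ht')).trans ?_
  have h1 : |(|x + t * y| - |x + t' * y|)| ≤ M * |t - t'| := by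
    refine (abs_abs_sub_abs_le_abs_sub _ _).trans ?_
    rw [add_sub_add_left_eq_sub, ← sub_mul, abs_mul, mul_comm]
    gcongr
  rw [mul_assoc _ M]
  gcongr
  linarith

lemma hasDerivAt_abs_rpow_of_ne_zero {s x : ℝ} (hx : x ≠ 0) :
    HasDerivAt (fun y => |y| ^ s) (s * (|x| ^ (s - 2) * x)) x := by
  have hx' : 0 < |x| := abs_pos.2 hx
  convert (hasDerivAt_abs hx).rpow_const (p := s) (.inl hx'.ne') using 1
  rw [show s - 1 = s - 2 + 1 by ring, Real.rpow_add_one hx'.ne', mul_comm _ s]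
  linear_combination (-s * |x| ^ (s - 2)) * sign_mul_abs x

lemma hasDerivAt_abs_add_mul_rpow {s x y : ℝ} (h : x ≠ 0 ∨ 1 < s) :
    HasDerivAt (fun t => |x + t * y| ^ s) (s * (|x| ^ (s - 2) * x) * y) 0 := by
  have h1 : HasDerivAt (fun y => |y| ^ s) (s * (|x| ^ (s - 2) * x)) (x + 0 * y) := by
    rw [zero_mul, add_zero]
    rcases h with h | h
    · exact hasDerivAt_abs_rpow_of_ne_zero h
    · simpa [mul_assoc] using hasDerivAt_abs_rpow x h
  have h2 : HasDerivAt (fun t => x + t * y) y 0 := by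
    simpa using ((hasDerivAt_id (0 : ℝ)).mul_const y).const_add x
  exact h1.comp 0 h2

/-- At `x = 0` the two terms cancel identically, and the formula gives `0` there through its factor
`x`. Hence no lower bound on `s` is needed, and `s = 1` is covered. -/
lemma hasDerivAt_abs_add_mul_rpow_symm (s x y : ℝ) :
    HasDerivAt (fun t => |x + t * y| ^ s - |x + -t * y| ^ s)
      (2 * (s * (|x| ^ (s - 2) * x) * y)) 0 := by
  rcases eq_or_ne x 0 with rfl | hx
  · simpa using hasDerivAt_const (0 : ℝ) (0 : ℝ)
  · have h1 := hasDerivAt_abs_add_mul_rpow (s := s) (y := y) (.inl hx)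
    have h2 : HasDerivAt (fun t => |x + -t * y| ^ s) (-(s * (|x| ^ (s - 2) * x) * y)) 0 := by
      have h := hasDerivAt_abs_add_mul_rpow (s := s) (y := -y) (.inl hx)
      simp only [mul_neg] at h
      simpa using h
    exact (h1.sub h2).congr_deriv (by ring)

lemma aestronglyMeasurable_abs_rpow_mul {X : Type*} [MeasurableSpace X] {μ : Measure X}
    {s : ℝ} {f : X → ℝ} (hf : AEStronglyMeasurable f μ) :
    AEStronglyMeasurable (fun x => |f x| ^ (s - 2) * f x) μ :=
  ((hf.aemeasurable.abs.pow_const (s - 2)).mul hf.aemeasurable).aestronglyMeasurable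

section Measure

variable {X : Type*} [MeasurableSpace X] {μ : Measure X} [IsFiniteMeasure μ] {s M : ℝ}
  {f g : X → ℝ}

lemma integrable_abs_add_const_rpow (hs : 1 ≤ s) (hf : MemLp f (ENNReal.ofReal s) μ) {K : ℝ}
    (hK : 0 ≤ K) : Integrable (fun x => (|f x| + K) ^ s) μ := by
  have h1 : MemLp (fun x => |f x| + K) (ENNReal.ofReal s) μ := hf.abs.add (memLp_const K)
  have h2 := h1.integrable_norm_rpow (by simp; linarith) (by simp)
  rw [ENNReal.toReal_ofReal (by linarith)] at h2
  refine h2.congr (.of_forall fun x => ?_)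
  simp only
  rw [Real.norm_of_nonneg (by positivity)]

lemma integrable_abs_add_mul_rpow (hs : 1 ≤ s) (hf : MemLp f (ENNReal.ofReal s) μ)
    (hg : AEStronglyMeasurable g μ) (hgM : ∀ x, |g x| ≤ M) (t : ℝ) :
    Integrable (fun x => |f x + t * g x| ^ s) μ := by
  have h1 : MemLp (fun x => f x + t * g x) (ENNReal.ofReal s) μ :=
    hf.add ((MemLp.of_bound hg M (.of_forall hgM)).const_mul t)
  have h2 := h1.integrable_norm_rpow (by simp; linarith) (by simp)
  rwa [ENNReal.toReal_ofReal (by linarith)] at h2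

lemma integrable_bound (hs : 1 ≤ s) (hf : MemLp f (ENNReal.ofReal s) μ) (hM : 0 ≤ M) :
    Integrable (fun x => s * (|f x| + M + 1) ^ s * M) μ := by
  have := integrable_abs_add_const_rpow hs hf (K := M + 1) (by linarith)
  simp_rw [← add_assoc] at this
  exact (this.const_mul s).mul_const M

lemma integrable_abs_rpow_mul (hs : 1 ≤ s) (hf : MemLp f (ENNReal.ofReal s) μ) :
    Integrable (fun x => |f x| ^ (s - 2) * f x) μ := by
  refine (integrable_abs_add_const_rpow hs hf zero_le_one).mono'
    (aestronglyMeasurable_abs_rpow_mul hf.aestronglyMeasurable) (.of_forall fun x => ?_)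
  rcases eq_or_ne (f x) 0 with h | h
  · simp [h]
  · have h0 : 0 < |f x| := abs_pos.2 h
    rw [norm_mul, Real.norm_of_nonneg (by positivity), Real.norm_eq_abs,
      ← Real.rpow_add_one h0.ne', show s - 2 + 1 = s - 1 by ring]
    calc |f x| ^ (s - 1) ≤ (|f x| + 1) ^ (s - 1) := by gcongr; linarith
      _ ≤ (|f x| + 1) ^ s := Real.rpow_le_rpow_of_exponent_le (by linarith) (by linarith)

/-- Gateaux derivative of `∫ |f|^s` in a bounded direction, `s > 1`. -/
lemma hasDerivAt_integral_abs_rpow (hs : 1 < s) (hf : MemLp f (ENNReal.ofReal s) μ)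
    (hg : AEStronglyMeasurable g μ) (hgM : ∀ x, |g x| ≤ M) (hM : 0 ≤ M) :
    HasDerivAt (fun t : ℝ => ∫ x, |f x + t * g x| ^ s ∂μ)
      (∫ x, s * (|f x| ^ (s - 2) * f x) * g x ∂μ) 0 := by
  have hint := integrable_abs_add_mul_rpow hs.le hf hg hgM
  refine (hasDerivAt_integral_of_dominated_loc_of_lip
    (F := fun t x => |f x + t * g x| ^ s) (s := Set.Icc (-1) 1)
    (bound := fun x => s * (|f x| + M + 1) ^ s * M) (Icc_mem_nhds (by norm_num) (by norm_num))
    (.of_forall fun t => (hint t).aestronglyMeasurable) (hint 0)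
    (((aestronglyMeasurable_abs_rpow_mul hf.aestronglyMeasurable).const_mul s).mul hg)
    (.of_forall fun x => ?_) (integrable_bound hs.le hf hM)
    (.of_forall fun x => hasDerivAt_abs_add_mul_rpow (.inr hs))).2
  refine LipschitzOnWith.of_dist_le_mul fun t ht t' ht' => ?_
  have hB : 0 ≤ s * (|f x| + M + 1) ^ s * M := by positivity
  rw [Real.coe_nnabs, abs_of_nonneg hB]
  exact abs_add_mul_rpow_sub_le hs.le (hgM x) ht ht'

/-- Symmetric Gateaux derivative of `∫ |f|^s` in a bounded direction, `s ≥ 1`. -/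
lemma hasDerivAt_integral_abs_rpow_symm (hs : 1 ≤ s) (hf : MemLp f (ENNReal.ofReal s) μ)
    (hg : AEStronglyMeasurable g μ) (hgM : ∀ x, |g x| ≤ M) (hM : 0 ≤ M) :
    HasDerivAt (fun t : ℝ => ∫ x, |f x + t * g x| ^ s ∂μ - ∫ x, |f x + -t * g x| ^ s ∂μ)
      (2 * ∫ x, s * (|f x| ^ (s - 2) * f x) * g x ∂μ) 0 := by
  have hint := integrable_abs_add_mul_rpow hs hf hg hgM
  simp_rw [← integral_sub (hint _) (hint _)]
  rw [← integral_const_mul]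
  refine (hasDerivAt_integral_of_dominated_loc_of_lip
    (F := fun t x => |f x + t * g x| ^ s - |f x + -t * g x| ^ s) (s := Set.Icc (-1) 1)
    (bound := fun x => 2 * (s * (|f x| + M + 1) ^ s * M))
    (Icc_mem_nhds (by norm_num) (by norm_num))
    (.of_forall fun t => ((hint t).sub (hint (-t))).aestronglyMeasurable)
    ((hint 0).sub (hint (-0)))
    ((((aestronglyMeasurable_abs_rpow_mul hf.aestronglyMeasurable).const_mul s).mul hg).const_mul 2)
    (.of_forall fun x => ?_) ((integrable_bound hs hf hM).const_mul 2)
    (.of_forall fun x => hasDerivAt_abs_add_mul_rpow_symm s (f x) (g x))).2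
  refine LipschitzOnWith.of_dist_le_mul fun t ht t' ht' => ?_
  have hB : 0 ≤ 2 * (s * (|f x| + M + 1) ^ s * M) := by positivity
  rw [Real.coe_nnabs, abs_of_nonneg hB, Real.dist_eq, Real.dist_eq]
  have h1 := abs_add_mul_rpow_sub_le (x := f x) hs (hgM x) ht ht'
  have h2 := abs_add_mul_rpow_sub_le (x := f x) (t := -t) (t' := -t') hs (hgM x)
    ⟨by linarith [ht.2], by linarith [ht.1]⟩ ⟨by linarith [ht'.2], by linarith [ht'.1]⟩
  rw [show -t - -t' = -(t - t') by ring, abs_neg] at h2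
  rw [sub_sub_sub_comm]
  refine (abs_sub _ _).trans ?_
  linarith

end Measure

/-- If two of the quotients `G / (a^(αp/q) b^((1-α)p/r))` are stationary, then `a` is differentiable
when `b` is, with `a' / (q a) = b' / (r b)`. -/
lemma hasDerivAt_of_stationary {p q r α₁ α₂ b' : ℝ} {G a b : ℝ → ℝ} (hp : 0 < p) (hq : 0 < q)
    (hα : α₁ ≠ α₂) (ha : ∀ t, 0 ≤ a t) (hG : G 0 ≠ 0) (ha0 : 0 < a 0) (hb0 : 0 < b 0)
    (hb : HasDerivAt b b' 0)
    (h₁ : HasDerivAt (fun t => G t / (a t ^ (α₁ * p / q) * b t ^ ((1 - α₁) * p / r))) 0 0)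
    (h₂ : HasDerivAt (fun t => G t / (a t ^ (α₂ * p / q) * b t ^ ((1 - α₂) * p / r))) 0 0) :
    HasDerivAt a (q * a 0 * (b' / (r * b 0))) 0 := by
  set R₁ := fun t => G t / (a t ^ (α₁ * p / q) * b t ^ ((1 - α₁) * p / r)) with hR₁
  set R₂ := fun t => G t / (a t ^ (α₂ * p / q) * b t ^ ((1 - α₂) * p / r)) with hR₂
  have hα' : α₂ - α₁ ≠ 0 := sub_ne_zero.2 hα.symm
  have h10 : R₁ 0 ≠ 0 := by simp only [hR₁]; positivity
  have h20 : R₂ 0 ≠ 0 := by simp only [hR₂]; positivity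
  -- Solve `log R₁ - log R₂` for `a`; `G` cancels, so its differentiability is never required.
  have hev : a =ᶠ[𝓝 0] fun t => Real.exp (q / ((α₂ - α₁) * p) *
      (Real.log (R₁ t) - Real.log (R₂ t) + (α₂ - α₁) * p / r * Real.log (b t))) := by
    filter_upwards [h₁.continuousAt.eventually_ne h10, h₂.continuousAt.eventually_ne h20,
      hb.continuousAt.eventually (lt_mem_nhds hb0)] with t h1 h2 hbt
    -- If `a t = 0`, a quotient with `α ≠ 0` has denominator `0`, hence value `0` by convention. One
    -- of `α₁`, `α₂` is nonzero, while both quotients are nonzero near `0`.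
    have hat : 0 < a t := by
      refine (ha t).lt_of_ne' fun h => ?_
      rcases eq_or_ne α₁ 0 with h0 | h0
      · refine h2 ?_
        have : α₂ * p / q ≠ 0 := by
          have : α₂ ≠ 0 := fun h' => hα (h0.trans h'.symm)
          positivity
        simp [hR₂, h, Real.zero_rpow this]
      · refine h1 ?_
        have : α₁ * p / q ≠ 0 := by positivity
        simp [hR₁, h, Real.zero_rpow this]
    have hGt : G t ≠ 0 := fun h => h1 (by simp [hR₁, h])
    simp only [hR₁, hR₂]
    rw [Real.log_div hGt (by positivity), Real.log_div hGt (by positivity),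
      Real.log_mul (by positivity) (by positivity), Real.log_mul (by positivity) (by positivity),
      Real.log_rpow hat, Real.log_rpow hat, Real.log_rpow hbt, Real.log_rpow hbt]
    conv_lhs => rw [← Real.exp_log hat]
    congr 1
    field_simp
    ring
  have hd := ((((h₁.log h10).sub (h₂.log h20)).add
    ((hb.log hb0.ne').const_mul ((α₂ - α₁) * p / r))).const_mul
      (q / ((α₂ - α₁) * p))).exp
  refine (hd.congr_of_eventuallyEq hev).congr_deriv ?_
  have h0 := hev.self_of_nhds
  simp only [Pi.add_apply, Pi.sub_apply] at h0 ⊢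
  rw [← h0]
  field_simp
  ring

end Rayleigh

/-! ### Scaling invariance and common critical points. -/

namespace Rayleigh

open Filter Topology

variable {N : ℕ} {p : ℝ} [Fact (1 < p)] {Ω : Set (EuclideanSpace ℝ (Fin N))}

/-- A test function as an element of `W_0^{1,p}(Ω)`. -/
lemma exists_sobolevZero_of_test {φ : EuclideanSpace ℝ (Fin N) → ℝ} (hφ : ContDiff ℝ ∞ φ)
    (hφc : HasCompactSupport φ) (hφs : tsupport φ ⊆ Ω) :
    ∃ w : sobolevZero N p Ω, w.1.1 =ᵐ[volume.restrict Ω] φ := by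
  have h1 : MemLp φ (ENNReal.ofReal p) (volume.restrict Ω) :=
    hφ.continuous.memLp_of_hasCompactSupport hφc
  have h2 : MemLp (gradient φ) (ENNReal.ofReal p) (volume.restrict Ω) :=
    (continuous_gradient hφ).memLp_of_hasCompactSupport (hasCompactSupport_gradient hφc)
  exact ⟨⟨(h1.toLp, h2.toLp), (testPairs N p Ω).le_topologicalClosure
    ⟨φ, hφ, hφc, hφs, h1.coeFn_toLp, h2.coeFn_toLp⟩⟩, h1.coeFn_toLp⟩

lemma rayleighQuotient_smul {q r : ℝ} (hq : q ≠ 0) (hr : r ≠ 0) (α : ℝ) {k : ℝ} (hk : k ≠ 0)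
    (u : sobolevZero N p Ω) :
    rayleighQuotient q r α (k • u) = rayleighQuotient q r α u := by
  have hk' : 0 < |k| := abs_pos.2 hk
  have h1 : ∀ s : ℝ, ∫ x in Ω, |(k • u).1.1 x| ^ s = |k| ^ s * ∫ x in Ω, |u.1.1 x| ^ s := by
    intro s
    rw [← integral_const_mul]
    refine integral_congr_ae ?_
    filter_upwards [Lp.coeFn_smul k u.1.1] with x hx
    have hx' : (k • u).1.1 x = k * u.1.1 x := hx
    rw [hx', abs_mul, Real.mul_rpow (abs_nonneg _) (abs_nonneg _)]
  have h2 : ∫ x in Ω, ‖(k • u).1.2 x‖ ^ p = |k| ^ p * ∫ x in Ω, ‖u.1.2 x‖ ^ p := by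
    rw [← integral_const_mul]
    refine integral_congr_ae ?_
    filter_upwards [Lp.coeFn_smul k u.1.2] with x hx
    have hx' : (k • u).1.2 x = k • u.1.2 x := hx
    rw [hx', norm_smul, Real.mul_rpow (norm_nonneg _) (norm_nonneg _), Real.norm_eq_abs]
  have h0 : ∀ s : ℝ, 0 ≤ ∫ x in Ω, |u.1.1 x| ^ s := fun s =>
    integral_nonneg fun x => by positivity
  rw [rayleighQuotient, rayleighQuotient, h1, h1, h2, Real.mul_rpow (by positivity) (h0 _),
    Real.mul_rpow (by positivity) (h0 _), ← Real.rpow_mul hk'.le, ← Real.rpow_mul hk'.le,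
    mul_mul_mul_comm, ← Real.rpow_add hk']
  -- The denominator is homogeneous of degree `p`, like the numerator.
  have he : q * (α * p / q) + r * ((1 - α) * p / r) = p := by field_simp; ring
  rw [he, mul_div_mul_left _ _ (by positivity)]

lemma IsCriticalPoint.smul {q r α : ℝ} (hq : q ≠ 0) (hr : r ≠ 0) {k : ℝ} (hk : k ≠ 0)
    {u : sobolevZero N p Ω} (hu : IsCriticalPoint q r α u) : IsCriticalPoint q r α (k • u) := by
  refine ⟨smul_ne_zero hk hu.1, ?_⟩
  have h1 : HasFDerivAt (rayleighQuotient q r α) (0 : sobolevZero N p Ω →L[ℝ] ℝ)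
      (k⁻¹ • (k • u)) := by
    rw [inv_smul_smul₀ hk]; exact hu.2
  have h2 := h1.comp (k • u)
    ((k⁻¹ • ContinuousLinearMap.id ℝ (sobolevZero N p Ω)).hasFDerivAt)
  rw [ContinuousLinearMap.zero_comp] at h2
  refine h2.congr_of_eventuallyEq (.of_forall fun v => ?_)
  exact (rayleighQuotient_smul hq hr α (inv_ne_zero hk) v).symm

lemma integral_abs_rpow_pos {X E : Type*} [MeasurableSpace X] {μ : Measure X}
    [NormedAddCommGroup E] {f : X → E} {s : ℝ} (hs : 0 < s) (hf : MemLp f (ENNReal.ofReal s) μ)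
    (h : ¬ f =ᵐ[μ] 0) : 0 < ∫ x, ‖f x‖ ^ s ∂μ := by
  refine (integral_nonneg fun x => by positivity).lt_of_ne' fun h0 => h ?_
  have hint := hf.integrable_norm_rpow (by simpa using hs) (by simp)
  rw [ENNReal.toReal_ofReal hs.le] at hint
  rw [integral_eq_zero_iff_of_nonneg (fun x => by positivity) hint] at h0
  filter_upwards [h0] with x hx
  simpa [Real.rpow_eq_zero_iff_of_nonneg, hs.ne'] using hx

/-- The Euler–Lagrange identity of the quotient `(∫ |u|^q)^(1/q) / (∫ |u|^r)^(1/r)` at a common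
critical point of `R_α₁` and `R_α₂`. -/
lemma integral_mul_eq_of_isCriticalPoint {q r α₁ α₂ : ℝ} (hq : 1 ≤ q) (hr : 1 < r)
    (hα : α₁ ≠ α₂) (hΩb : Bornology.IsBounded Ω) {u : sobolevZero N p Ω}
    (huq : MemLp u.1.1 (ENNReal.ofReal q) (volume.restrict Ω))
    (hur : MemLp u.1.1 (ENNReal.ofReal r) (volume.restrict Ω))
    (hG : 0 < ∫ x in Ω, ‖u.1.2 x‖ ^ p) (hA : 0 < ∫ x in Ω, |u.1.1 x| ^ q)
    (hB : 0 < ∫ x in Ω, |u.1.1 x| ^ r)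
    (h₁ : IsCriticalPoint q r α₁ u) (h₂ : IsCriticalPoint q r α₂ u)
    {φ : EuclideanSpace ℝ (Fin N) → ℝ} (hφ : ContDiff ℝ ∞ φ) (hφc : HasCompactSupport φ)
    (hφs : tsupport φ ⊆ Ω) :
    (∫ x in Ω, |u.1.1 x| ^ (q - 2) * u.1.1 x * φ x) / ∫ x in Ω, |u.1.1 x| ^ q =
      (∫ x in Ω, |u.1.1 x| ^ (r - 2) * u.1.1 x * φ x) / ∫ x in Ω, |u.1.1 x| ^ r := by
  have hfin : IsFiniteMeasure (volume.restrict Ω) := ⟨by simpa using hΩb.measure_lt_top⟩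
  have hp : 1 < p := Fact.out
  obtain ⟨w, hw⟩ := exists_sobolevZero_of_test (p := p) hφ hφc hφs
  obtain ⟨M, hM⟩ := hφ.continuous.bounded_above_of_compact_support hφc
  have hM0 : 0 ≤ M := (norm_nonneg _).trans (hM 0)
  have hφm : AEStronglyMeasurable φ (volume.restrict Ω) := hφ.continuous.aestronglyMeasurable
  have hfun : ∀ s t : ℝ, ∫ x in Ω, |(u + t • w).1.1 x| ^ s =
      ∫ x in Ω, |u.1.1 x + t * φ x| ^ s := by
    intro s t
    refine integral_congr_ae ?_
    filter_upwards [Lp.coeFn_add u.1.1 (t • w.1.1), Lp.coeFn_smul t w.1.1, hw] with x h1 h2 h3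
    have h4 : (u + t • w).1.1 x = u.1.1 x + t * φ x := by
      refine h1.trans ?_
      rw [Pi.add_apply, h2, Pi.smul_apply, h3, smul_eq_mul]
    simp only [h4]
  have hline : HasDerivAt (fun t : ℝ => u + t • w) w 0 := by
    simpa using ((hasDerivAt_id (0 : ℝ)).smul_const w).const_add u
  have hder : ∀ α, IsCriticalPoint q r α u →
      HasDerivAt (fun t : ℝ => (∫ x in Ω, ‖(u + t • w).1.2 x‖ ^ p) /
        ((∫ x in Ω, |u.1.1 x + t * φ x| ^ q) ^ (α * p / q) *
          (∫ x in Ω, |u.1.1 x + t * φ x| ^ r) ^ ((1 - α) * p / r))) 0 0 := by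
    intro α h
    have h1 : HasFDerivAt (rayleighQuotient q r α) (0 : sobolevZero N p Ω →L[ℝ] ℝ)
        (u + (0 : ℝ) • w) := by simpa using h.2
    have h2 := h1.comp_hasDerivAt (0 : ℝ) hline
    simp_rw [← hfun]
    exact h2
  have hb := hasDerivAt_integral_abs_rpow hr hur hφm hM hM0
  have ha := hasDerivAt_of_stationary (by linarith) (by linarith) hα
    (fun t => integral_nonneg fun x => by positivity) (by simpa using hG.ne')
    (by simpa using hA) (by simpa using hB) hb (hder α₁ h₁) (hder α₂ h₂)
  have ha' := hasDerivAt_integral_abs_rpow_symm hq huq hφm hM hM0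
  have hneg := HasDerivAt.scomp_of_eq (0 : ℝ) ha (hasDerivAt_neg (0 : ℝ)) neg_zero.symm
  -- Stationarity makes `a` differentiable, so its symmetric derivative is twice its derivative;
  -- comparison with the explicit symmetric derivative gives the identity even for `q = 1`.
  have heq := ha'.unique (ha.sub hneg)
  simp only [mul_assoc, integral_const_mul, zero_mul, add_zero, smul_eq_mul] at heq ⊢
  rw [mul_div_mul_left _ _ (by linarith : r ≠ 0)] at heq
  have hq0 : q ≠ 0 := by linarith
  rw [div_eq_iff hA.ne']
  have h2q : (2 * q) * (∫ x in Ω, |u.1.1 x| ^ (q - 2) * (u.1.1 x * φ x)) = (2 * q) *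
    ((∫ x in Ω, |u.1.1 x| ^ (r - 2) * (u.1.1 x * φ x)) / (∫ x in Ω, |u.1.1 x| ^ r) *
      ∫ x in Ω, |u.1.1 x| ^ q) := by linear_combination heq
  exact mul_left_cancel₀ (by positivity) h2q

lemma not_isCriticalPoint_and {q r α₁ α₂ : ℝ} (hN : 1 ≤ N) (hq : 1 ≤ q) (hqr : q < r)
    (hr : p < N → r < N * p / (N - p)) (hΩ : IsOpen Ω) (hΩb : Bornology.IsBounded Ω)
    (hα : α₁ ≠ α₂) (u : sobolevZero N p Ω) :
    ¬ (IsCriticalPoint q r α₁ u ∧ IsCriticalPoint q r α₂ u) := by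
  rintro ⟨h₁, h₂⟩
  have hfin : IsFiniteMeasure (volume.restrict Ω) := ⟨by simpa using hΩb.measure_lt_top⟩
  have hp : 1 < p := Fact.out
  have hsnd : u.1.2 ≠ 0 := fun h => h₁.1 (eq_zero_of_snd_eq_zero hN (by linarith) hr hΩb u h)
  -- Elements are pairs, so a zero function must be shown to have zero gradient; the value `1` of
  -- `c` is arbitrary here.
  have hfst : ¬ u.1.1 =ᵐ[volume.restrict Ω] 0 := fun h =>
    hsnd (snd_eq_zero_of_abs_eq hΩ hΩb u one_pos (h.mono fun x hx => .inl hx))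
  have hur := memLp_fst hN (by linarith) hr hΩb u
  have huq := hur.mono_exponent (ENNReal.ofReal_le_ofReal hqr.le)
  have hG := integral_abs_rpow_pos (by linarith) (Lp.memLp u.1.2)
    fun h => hsnd (Lp.eq_zero_iff_ae_eq_zero.2 h)
  have hA : 0 < ∫ x in Ω, |u.1.1 x| ^ q := integral_abs_rpow_pos (by linarith) huq hfst
  have hB : 0 < ∫ x in Ω, |u.1.1 x| ^ r := integral_abs_rpow_pos (by linarith) hur hfst
  set A := ∫ x in Ω, |u.1.1 x| ^ q
  set B := ∫ x in Ω, |u.1.1 x| ^ r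
  have hiq := (integrable_abs_rpow_mul hq huq).div_const A
  have hir := (integrable_abs_rpow_mul (by linarith) hur).div_const B
  have hae := hΩ.ae_eq_zero_of_integral_contDiff_smul_eq_zero (μ := volume.restrict Ω)
    ((hiq.sub hir).locallyIntegrable.locallyIntegrableOn Ω) fun φ hφ hφc hφs => by
      obtain ⟨M, hM⟩ := hφ.continuous.bounded_above_of_compact_support hφc
      have key := integral_mul_eq_of_isCriticalPoint hq (by linarith) hα hΩb huq hur hG hA hB
        h₁ h₂ hφ hφc hφs
      have e : ∀ x, φ x • ((fun x => |u.1.1 x| ^ (q - 2) * u.1.1 x / A) -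
          fun x => |u.1.1 x| ^ (r - 2) * u.1.1 x / B) x =
          φ x * (|u.1.1 x| ^ (q - 2) * u.1.1 x / A) -
            φ x * (|u.1.1 x| ^ (r - 2) * u.1.1 x / B) := fun x => by
        rw [Pi.sub_apply, smul_eq_mul, mul_sub]
      have i₁ : Integrable (fun x => φ x * (|u.1.1 x| ^ (q - 2) * u.1.1 x / A))
          (volume.restrict Ω) :=
        hiq.bdd_mul hφ.continuous.aestronglyMeasurable (.of_forall hM)
      have i₂ : Integrable (fun x => φ x * (|u.1.1 x| ^ (r - 2) * u.1.1 x / B))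
          (volume.restrict Ω) :=
        hir.bdd_mul hφ.continuous.aestronglyMeasurable (.of_forall hM)
      refine (integral_congr_ae (.of_forall e)).trans ?_
      rw [integral_sub i₁ i₂, sub_eq_zero]
      rw [← integral_div, ← integral_div] at key
      refine Eq.trans ?_ (key.trans ?_) <;>
        exact integral_congr_ae (.of_forall fun x => by ring)
  -- Where `u ≠ 0`, dividing the pointwise equation by `|u|^(q-2) u` leaves `|u|^(r-q) = B / A`.
  refine hsnd (snd_eq_zero_of_abs_eq hΩ hΩb u (c := (B / A) ^ (r - q)⁻¹) (by positivity) ?_)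
  filter_upwards [hae, ae_restrict_mem hΩ.measurableSet] with x hx hxΩ
  refine or_iff_not_imp_left.2 fun h0 => ?_
  have hpos : 0 < |u.1.1 x| := abs_pos.2 h0
  have h1 := hx hxΩ
  rw [Pi.sub_apply, sub_eq_zero, div_eq_div_iff hA.ne' hB.ne'] at h1
  have h2 : |u.1.1 x| ^ (r - q) = B / A := by
    have h3 : |u.1.1 x| ^ (r - 2) = |u.1.1 x| ^ (q - 2) * |u.1.1 x| ^ (r - q) := by
      rw [← Real.rpow_add hpos]; ring_nf
    rw [h3] at h1
    have h4 : 0 < |u.1.1 x| ^ (q - 2) := by positivity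
    rw [eq_div_iff hA.ne']
    refine mul_left_cancel₀ (mul_ne_zero h4.ne' h0) ?_
    linear_combination -h1
  rw [← h2, Real.rpow_rpow_inv hpos.le (by linarith)]

end Rayleigh

theorem mainTheorem12 (N : ℕ) (hN : 1 ≤ N) (p q r : ℝ) [Fact (1 < p)]
    (hq : 1 ≤ q) (hqr : q < r) (hr : p < N → r < N * p / (N - p))
    (Ω : Set (EuclideanSpace ℝ (Fin N))) (hΩ : IsOpen Ω) (hΩb : Bornology.IsBounded Ω)
    (α₁ α₂ : ℝ) (hα : α₁ ≠ α₂) :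
    (∀ u : Rayleigh.sobolevZero N p Ω,
      ¬ (Rayleigh.IsCriticalPoint q r α₁ u ∧ Rayleigh.IsCriticalPoint q r α₂ u)) ∧
    (∀ u₁ u₂ : Rayleigh.sobolevZero N p Ω,
      Rayleigh.IsCriticalPoint q r α₁ u₁ → Rayleigh.IsCriticalPoint q r α₂ u₂ →
        LinearIndependent ℝ ![u₁, u₂]) := by
  have main := Rayleigh.not_isCriticalPoint_and (p := p) hN hq hqr hr hΩ hΩb hα
  -- Dependence would mean `k • u₁ = u₂` with `k ≠ 0`; by scaling, `u₂` would then be critical for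
  -- both quotients.
  refine ⟨main, fun u₁ u₂ h₁ h₂ => (LinearIndependent.pair_iff' h₁.1).2 fun k hk => ?_⟩
  have hk0 : k ≠ 0 := by
    rintro rfl
    exact h₂.1 (by rw [← hk, zero_smul])
  exact main u₂ ⟨hk ▸ h₁.smul (by linarith) (by linarith) hk0, h₂⟩
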